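/- Let $(M,d)$ be a Polish metric space (a complete separable metric space). Let $\mathrm{TP}(M)$ be the real vector space of finitely supported functions $f:M\to\mathbb{R}$ with $\sum_{v\in M}f(v)=0$, with the norm $$\|f\|_{\mathrm{TC}}=\inf\Big\{\sum_{i=1}^n a_i\,d(x_i,y_i)\;:\; n\ge 0,\ a_i\ge 0,\ x_i,y_i\in M,\ f=\sum_{i=1}^n a_i(\mathbf 1_{x_i}-\mathbf 1_{y_i})\Big\},$$ and let $\mathrm{TC}(M)$ be the completion of $(\mathrm{TP}(M),\|\cdot\|_{\mathrm{TC}})$. Let $\mathcal M$ be the vector space of all differences $\mu-\nu$ of finite (positive) Borel measures on $M$ with $\mu(M)=\nu(M)$ and with finite first moments, that is, $\int_M d(x,x_0)\,d\mu(x)<\infty$ and $\int_M d(x,x_0)\,d\nu(x)<\infty$ for all (equivalently, some) $x_0\in M$. For such $\mu,\nu$ put $$\mathcal T_1(\mu,\nu)=\inf_{\pi}\iint_{M\times M}d(x,y)\,d\pi(x,y),$$ where $\pi$ runs over all Borel measures on $M\times M$ with $\pi(A\times M)=\mu(A)$ and $\pi(M\times A)=\nu(A)$ for every Borel set $A\subset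 M$. Then $\mathcal T_1(\mu,\nu)$ is finite and depends only on $\mu-\nu$, and $\|\mu-\nu\|_{\mathrm{KR}}=\mathcal T_1(\mu,\nu)$ is a norm on $\mathcal M$. The linear map $\iota:\mathrm{TP}(M)\to\mathcal M$, $\iota(f)=\sum_{v}f(v)\delta_v$, where $\delta_v$ is the unit atomic measure at $v$, satisfies $\|\iota(f)\|_{\mathrm{KR}}=\|f\|_{\mathrm{TC}}$ for all $f\in \mathrm{TP}(M)$, and its image is dense in $(\mathcal M,\|\cdot\|_{\mathrm{KR}})$. Hence $\mathrm{TC}(M)$ is the completion of $(\mathcal M,\|\cdot\|_{\mathrm{KR}})$: there is a surjective linear isometry from the completion of $(\mathcal M,\|\cdot\|_{\mathrm{KR}})$ onto $\mathrm{TC}(M)$ that sends $\iota(f)$ to $f$ for every $f\in\mathrm{TP}(M)$. -/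

import Mathlib

open MeasureTheory Topology
open scoped ENNReal NNReal

noncomputable section

namespace TransportCost

/-! ### Transportation problems and the transportation cost norm -/

/-- The finitely supported real-valued functions on `M` with zero sum, as a subspace of all
finitely supported functions. -/
def tpSubmodule (M : Type*) : Submodule ℝ (M →₀ ℝ) where
  carrier := {f | (f.sum fun _ a => a) = 0}
  zero_mem' := by simp
  add_mem' := by
    intro f g hf hg
    simp only [Set.mem_ofPred_eq] at *
    rw [Finsupp.sum_add_index' (by simp) (by simp), hf, hg, add_zero]
  smul_mem' := by
    intro c f hf
    simp only [Set.mem_ofPred_eq] at *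
    rw [Finsupp.sum_smul_index' (by simp)]
    simp only [smul_eq_mul]
    rw [Finsupp.sum, ← Finset.mul_sum]
    change c * (f.sum fun _ a => a) = 0
    rw [hf, mul_zero]

/-- The vector space `TP(M)` of transportation problems on `M`. -/
def TP (M : Type*) : Type _ := ↥(tpSubmodule M)

instance (M : Type*) : AddCommGroup (TP M) := inferInstanceAs (AddCommGroup ↥(tpSubmodule M))

instance (M : Type*) : Module ℝ (TP M) := inferInstanceAs (Module ℝ ↥(tpSubmodule M))

/-- A transportation plan: a finite list of triples `(a, x, y)`, each meaning
"deliver `a ≥ 0` units of the product from `x` to `y`". -/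
abbrev Plan (M : Type*) : Type _ := List (ℝ≥0 × M × M)

/-- The problem solved by a plan, `∑ aᵢ (1_{xᵢ} - 1_{yᵢ})`. -/
def Plan.problem {M : Type*} (p : Plan M) : M →₀ ℝ :=
  (p.map fun t => (t.1 : ℝ) • (Finsupp.single t.2.1 (1 : ℝ) - Finsupp.single t.2.2 (1 : ℝ))).sum

/-- The cost of a plan, `∑ aᵢ d(xᵢ, yᵢ)`. -/
def Plan.cost {M : Type*} [MetricSpace M] (p : Plan M) : ℝ :=
  (p.map fun t => (t.1 : ℝ) * dist t.2.1 t.2.2).sum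

/-- The transportation cost `‖f‖_TC`: the least cost of a plan that solves `f`. -/
def tcNorm {M : Type*} [MetricSpace M] (f : M →₀ ℝ) : ℝ :=
  sInf {c : ℝ | ∃ p : Plan M, p.problem = f ∧ p.cost = c}

section tc

variable {M : Type*}

lemma Plan.problem_append (p q : Plan M) :
    Plan.problem (p ++ q) = p.problem + q.problem := by
  simp [Plan.problem]

lemma Plan.problem_cons (t : ℝ≥0 × M × M) (p : Plan M) :
    Plan.problem (t :: p) =
      (t.1 : ℝ) • (Finsupp.single t.2.1 (1 : ℝ) - Finsupp.single t.2.2 (1 : ℝ)) + p.problem := by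
  simp [Plan.problem]

lemma Plan.problem_nil : Plan.problem ([] : Plan M) = 0 := by
  simp [Plan.problem]

/-- Multiply all amounts of a plan by `|c|`, and reverse all deliveries if `c < 0`. -/
def Plan.scale (c : ℝ) (p : Plan M) : Plan M :=
  p.map fun t => if 0 ≤ c then (c.toNNReal * t.1, t.2.1, t.2.2)
    else ((-c).toNNReal * t.1, t.2.2, t.2.1)

lemma Plan.problem_scale (c : ℝ) (p : Plan M) :
    Plan.problem (p.scale c) = c • p.problem := by
  induction p with
  | nil => simp [Plan.scale, Plan.problem]
  | cons t p ih =>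
    have h : Plan.scale c (t :: p) = (if 0 ≤ c then (c.toNNReal * t.1, t.2.1, t.2.2)
        else ((-c).toNNReal * t.1, t.2.2, t.2.1)) :: Plan.scale c p := rfl
    rw [h, Plan.problem_cons, Plan.problem_cons, ih, smul_add]
    congr 1
    split_ifs with hc
    · simp [Real.coe_toNNReal _ hc, mul_smul]
    · rw [smul_smul]
      simp only [NNReal.coe_mul, Real.coe_toNNReal _ (by linarith : (0 : ℝ) ≤ -c)]
      rw [← neg_sub (Finsupp.single t.2.1 (1 : ℝ)), smul_neg, neg_mul, neg_smul, neg_neg]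

/-- Every zero-sum finitely supported function is solved by some plan. -/
lemma exists_plan {f : M →₀ ℝ} (hf : f ∈ tpSubmodule M) : ∃ p : Plan M, p.problem = f := by
  classical
  rcases isEmpty_or_nonempty M with hM | ⟨⟨o⟩⟩
  · exact ⟨[], by ext x; exact (hM.false x).elim⟩
  · have key : ∀ g : M →₀ ℝ, ∃ p : Plan M,
        p.problem = g - Finsupp.single o (g.sum fun _ a => a) := by
      intro g
      induction g using Finsupp.induction_linear with
      | zero => exact ⟨[], by simp [Plan.problem]⟩
      | add g h hg hh =>
        obtain ⟨p, hp⟩ := hg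
        obtain ⟨q, hq⟩ := hh
        refine ⟨p ++ q, ?_⟩
        rw [Plan.problem_append, hp, hq, Finsupp.sum_add_index' (by simp) (by simp),
          Finsupp.single_add]
        abel
      | single x a =>
        refine ⟨Plan.scale a [(1, x, o)], ?_⟩
        rw [Plan.problem_scale, Plan.problem_cons, Plan.problem_nil]
        simp [smul_sub]
    obtain ⟨p, hp⟩ := key f
    refine ⟨p, ?_⟩
    rw [hp, show (f.sum fun _ a => a) = 0 from hf]
    simp

variable [MetricSpace M]

lemma Plan.cost_nonneg (p : Plan M) : 0 ≤ p.cost := by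
  apply List.sum_nonneg
  intro c hc
  simp only [List.mem_map] at hc
  obtain ⟨t, -, rfl⟩ := hc
  positivity

lemma Plan.cost_append (p q : Plan M) : Plan.cost (p ++ q) = p.cost + q.cost := by
  simp [Plan.cost]

lemma Plan.cost_cons (t : ℝ≥0 × M × M) (p : Plan M) :
    Plan.cost (t :: p) = (t.1 : ℝ) * dist t.2.1 t.2.2 + p.cost := by
  simp [Plan.cost]

lemma Plan.cost_scale (c : ℝ) (p : Plan M) : Plan.cost (p.scale c) = |c| * p.cost := by
  induction p with
  | nil => simp [Plan.scale, Plan.cost]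
  | cons t p ih =>
    have h : Plan.scale c (t :: p) = (if 0 ≤ c then (c.toNNReal * t.1, t.2.1, t.2.2)
        else ((-c).toNNReal * t.1, t.2.2, t.2.1)) :: Plan.scale c p := rfl
    rw [h, Plan.cost_cons, Plan.cost_cons, ih, mul_add]
    congr 1
    split_ifs with hc
    · simp [Real.coe_toNNReal _ hc, abs_of_nonneg hc, mul_assoc]
    · rw [abs_of_neg (by linarith)]
      simp only [NNReal.coe_mul, Real.coe_toNNReal _ (by linarith : (0 : ℝ) ≤ -c),
        dist_comm t.2.2 t.2.1]
      ring

lemma tcNorm_le {f : M →₀ ℝ} (p : Plan M) (hp : p.problem = f) : tcNorm f ≤ p.cost :=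
  csInf_le ⟨0, by rintro _ ⟨q, -, rfl⟩; exact q.cost_nonneg⟩ ⟨p, hp, rfl⟩

lemma le_tcNorm {f : M →₀ ℝ} (hf : f ∈ tpSubmodule M) {b : ℝ}
    (h : ∀ p : Plan M, p.problem = f → b ≤ p.cost) : b ≤ tcNorm f := by
  obtain ⟨p, hp⟩ := exists_plan hf
  refine le_csInf ⟨_, p, hp, rfl⟩ ?_
  rintro _ ⟨q, hq, rfl⟩
  exact h q hq

lemma tcNorm_nonneg (f : M →₀ ℝ) : 0 ≤ tcNorm f :=
  Real.sInf_nonneg (by rintro _ ⟨q, -, rfl⟩; exact q.cost_nonneg)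

lemma tcNorm_add_le {f g : M →₀ ℝ} (hf : f ∈ tpSubmodule M) (hg : g ∈ tpSubmodule M) :
    tcNorm (f + g) ≤ tcNorm f + tcNorm g := by
  rw [← sub_le_iff_le_add]
  refine le_tcNorm hf fun p hp => ?_
  rw [sub_le_iff_le_add, ← sub_le_iff_le_add']
  refine le_tcNorm hg fun q hq => ?_
  rw [sub_le_iff_le_add', ← Plan.cost_append]
  exact tcNorm_le _ (by rw [Plan.problem_append, hp, hq])

lemma tcNorm_smul_le (c : ℝ) {f : M →₀ ℝ} (hf : f ∈ tpSubmodule M) :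
    tcNorm (c • f) ≤ |c| * tcNorm f := by
  rcases eq_or_ne c 0 with rfl | hc
  · simpa [Plan.cost] using tcNorm_le ([] : Plan M) (f := 0) Plan.problem_nil
  · rw [← div_le_iff₀' (abs_pos.2 hc)]
    refine le_tcNorm hf fun p hp => ?_
    rw [div_le_iff₀' (abs_pos.2 hc), ← Plan.cost_scale]
    exact tcNorm_le _ (by rw [Plan.problem_scale, hp])

lemma tcNorm_smul (c : ℝ) {f : M →₀ ℝ} (hf : f ∈ tpSubmodule M) :
    tcNorm (c • f) = |c| * tcNorm f := by
  refine le_antisymm (tcNorm_smul_le c hf) ?_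
  rcases eq_or_ne c 0 with rfl | hc
  · simpa using tcNorm_nonneg _
  · have h := tcNorm_smul_le c⁻¹ ((tpSubmodule M).smul_mem c hf)
    rw [smul_smul, inv_mul_cancel₀ hc, one_smul, abs_inv] at h
    rwa [← le_inv_mul_iff₀ (abs_pos.2 hc)]

/-- A `1`-Lipschitz function bounds the cost of every plan from below. -/
lemma Plan.sum_le_cost {l : M → ℝ} (hl : ∀ x y, l x - l y ≤ dist x y) (p : Plan M) :
    (p.problem.sum fun x a => a * l x) ≤ p.cost := by
  induction p with
  | nil => simp [Plan.problem, Plan.cost]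
  | cons t p ih =>
    have e : ∀ f g : M →₀ ℝ, ((f + g).sum fun x a => a * l x) =
        (f.sum fun x a => a * l x) + g.sum fun x a => a * l x := fun f g =>
      Finsupp.sum_add_index' (by simp) (by intros; ring)
    rw [Plan.problem_cons, Plan.cost_cons, e]
    refine add_le_add ?_ ih
    rw [smul_sub, sub_eq_add_neg, e, ← smul_neg, ← Finsupp.single_neg]
    simp only [Finsupp.smul_single, smul_eq_mul]
    rw [Finsupp.sum_single_index (by simp), Finsupp.sum_single_index (by simp)]
    have := mul_le_mul_of_nonneg_left (hl t.2.1 t.2.2) t.1.2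
    simp only [NNReal.val_eq_coe] at this
    linarith

lemma eq_zero_of_tcNorm {f : M →₀ ℝ} (hf : f ∈ tpSubmodule M) (h : tcNorm f = 0) : f = 0 := by
  classical
  have pos : ∀ g ∈ tpSubmodule M, tcNorm g = 0 → ∀ x, g x ≤ 0 := by
    intro g hg h0 x
    obtain ⟨r, hr, hr'⟩ : ∃ r : ℝ, 0 < r ∧ ∀ y ∈ g.support, y ≠ x → r ≤ dist y x := by
      have hfin : (↑(g.support.erase x) : Set M).Finite := Finset.finite_toSet _
      have hcl : IsClosed (↑(g.support.erase x) : Set M) := hfin.isClosed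
      have : x ∈ (↑(g.support.erase x) : Set M)ᶜ := by simp
      obtain ⟨r, hr, hb⟩ := Metric.isOpen_iff.1 hcl.isOpen_compl x this
      refine ⟨r, hr, fun y hy hyx => ?_⟩
      by_contra hlt
      exact hb (Metric.mem_ball.2 (not_le.1 hlt)) (by simp [hyx, Finsupp.mem_support_iff.1 hy])
    have hl : ∀ y z : M, max 0 (r - dist y x) - max 0 (r - dist z x) ≤ dist y z := by
      intro y z
      rw [sub_le_iff_le_add]
      refine max_le (add_nonneg dist_nonneg (le_max_left _ _)) ?_
      have := dist_triangle z y x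
      rw [dist_comm z y] at this
      have h2 := le_max_right 0 (r - dist z x)
      linarith
    have hsum : (g.sum fun y a => a * max 0 (r - dist y x)) = g x * r := by
      rw [Finsupp.sum, Finset.sum_eq_single x]
      · simp [hr.le]
      · intro y hy hyx
        rw [max_eq_left (by linarith [hr' y hy hyx]), mul_zero]
      · intro hx
        simp [Finsupp.notMem_support_iff.1 hx]
    have hle : g x * r ≤ tcNorm g := le_tcNorm hg fun p hp => by
      rw [← hsum, ← hp]
      exact p.sum_le_cost hl
    rw [h0] at hle
    exact nonpos_of_mul_nonpos_left hle hr
  ext x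
  refine le_antisymm (pos f hf h x) ?_
  have h' : tcNorm ((-1 : ℝ) • f) = 0 := by rw [tcNorm_smul _ hf, h, mul_zero]
  have := pos _ ((tpSubmodule M).smul_mem (-1) hf) h' x
  simpa using this

instance : Norm (TP M) := ⟨fun f => tcNorm f.1⟩

lemma TP.core : NormedSpace.Core ℝ (TP M) where
  norm_nonneg f := tcNorm_nonneg f.1
  norm_smul c f := tcNorm_smul c f.2
  norm_triangle f g := tcNorm_add_le f.2 g.2
  norm_eq_zero_iff f := by
    refine ⟨fun h => Subtype.ext (eq_zero_of_tcNorm f.2 h), ?_⟩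
    rintro rfl
    have := tcNorm_smul (M := M) 0 (tpSubmodule M).zero_mem
    rw [zero_smul, abs_zero, zero_mul] at this
    exact this

/-- `TP(M)` with the norm `‖·‖_TC`. -/
instance : NormedAddCommGroup (TP M) := NormedAddCommGroup.ofCore TP.core

instance : NormedSpace ℝ (TP M) := NormedSpace.ofCore TP.core

end tc

/-- The transportation cost space `TC(M)`: the completion of `(TP(M), ‖·‖_TC)`. -/
abbrev TC (M : Type*) [MetricSpace M] : Type _ := UniformSpace.Completion (TP M)

/-! ### Couplings and the Kantorovich–Rubinstein space -/

section kr

variable {M : Type*} [MeasurableSpace M]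

/-- `π` is a coupling of `μ` and `ν`. -/
def IsCoupling (π : Measure (M × M)) (μ ν : FiniteMeasure M) : Prop :=
  (∀ A, MeasurableSet A → π (A ×ˢ Set.univ) = (μ : Measure M) A) ∧
    ∀ A, MeasurableSet A → π (Set.univ ×ˢ A) = (ν : Measure M) A

/-- The signed measure `μ - ν`. -/
def diff (μ ν : FiniteMeasure M) : SignedMeasure M :=
  (μ : Measure M).toSignedMeasure - (ν : Measure M).toSignedMeasure

lemma IsCoupling.map_fst {π : Measure (M × M)} {μ ν : FiniteMeasure M} (h : IsCoupling π μ ν) :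
    π.map Prod.fst = (μ : Measure M) := by
  ext A hA
  rw [Measure.map_apply measurable_fst hA, ← h.1 A hA, ← Set.prod_univ]

lemma IsCoupling.map_snd {π : Measure (M × M)} {μ ν : FiniteMeasure M} (h : IsCoupling π μ ν) :
    π.map Prod.snd = (ν : Measure M) := by
  ext A hA
  rw [Measure.map_apply measurable_snd hA, ← h.2 A hA, ← Set.univ_prod]

lemma IsCoupling.isFiniteMeasure {π : Measure (M × M)} {μ ν : FiniteMeasure M}
    (h : IsCoupling π μ ν) : IsFiniteMeasure π := by
  refine ⟨?_⟩
  rw [← Set.univ_prod_univ, h.1 _ MeasurableSet.univ]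
  exact measure_lt_top _ _

lemma IsCoupling.add {π ρ : Measure (M × M)} {μ ν μ' ν' : FiniteMeasure M}
    (h : IsCoupling π μ ν) (h' : IsCoupling ρ μ' ν') : IsCoupling (π + ρ) (μ + μ') (ν + ν') := by
  refine ⟨fun A hA => ?_, fun A hA => ?_⟩
  · simp [h.1 A hA, h'.1 A hA]
  · simp [h.2 A hA, h'.2 A hA]

lemma IsCoupling.smul {π : Measure (M × M)} {μ ν : FiniteMeasure M}
    (h : IsCoupling π μ ν) (c : ℝ≥0) : IsCoupling (c • π) (c • μ) (c • ν) := by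
  refine ⟨fun A hA => ?_, fun A hA => ?_⟩
  · simp [h.1 A hA]
  · simp [h.2 A hA]

lemma IsCoupling.swap {π : Measure (M × M)} {μ ν : FiniteMeasure M}
    (h : IsCoupling π μ ν) : IsCoupling (π.map Prod.swap) ν μ := by
  refine ⟨fun A hA => ?_, fun A hA => ?_⟩
  · rw [Measure.map_apply measurable_swap (hA.prod MeasurableSet.univ), Set.preimage_swap_prod,
      h.2 A hA]
  · rw [Measure.map_apply measurable_swap (MeasurableSet.univ.prod hA), Set.preimage_swap_prod,
      h.1 A hA]

lemma exists_isCoupling {μ ν : FiniteMeasure M} (h : μ.mass = ν.mass) :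
    ∃ π, IsCoupling π μ ν := by
  rcases eq_or_ne μ.mass 0 with h0 | h0
  · have h1 : μ = 0 := (FiniteMeasure.mass_zero_iff μ).1 h0
    have h2 : ν = 0 := (FiniteMeasure.mass_zero_iff ν).1 (h ▸ h0)
    exact ⟨0, by subst h1 h2; exact ⟨by simp, by simp⟩⟩
  · have hc : ((μ.mass : ℝ≥0∞)) ≠ 0 := by exact_mod_cast h0
    have hm : (μ : Measure M) Set.univ = μ.mass := by simp
    have hn : (ν : Measure M) Set.univ = μ.mass := by rw [h]; simp
    refine ⟨(μ.mass : ℝ≥0∞)⁻¹ • (μ : Measure M).prod (ν : Measure M),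
      fun A hA => ?_, fun A hA => ?_⟩
    · rw [Measure.smul_apply, Measure.prod_prod, hn, smul_eq_mul, mul_comm, mul_assoc,
        ENNReal.mul_inv_cancel hc ENNReal.coe_ne_top, mul_one]
    · rw [Measure.smul_apply, Measure.prod_prod, hm, smul_eq_mul, ← mul_assoc,
        ENNReal.inv_mul_cancel hc ENNReal.coe_ne_top, one_mul]

lemma diff_add (μ ν μ' ν' : FiniteMeasure M) :
    diff (μ + μ') (ν + ν') = diff μ ν + diff μ' ν' := by
  ext A hA
  simp only [diff, _root_.sub_apply, _root_.add_apply,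
    Measure.toSignedMeasure_apply_measurable hA, FiniteMeasure.toMeasure_add]
  rw [measureReal_add_apply, measureReal_add_apply]
  ring

lemma diff_smul (c : ℝ≥0) (μ ν : FiniteMeasure M) :
    diff (c • μ) (c • ν) = (c : ℝ) • diff μ ν := by
  ext A hA
  simp only [diff, _root_.sub_apply, _root_.smul_apply,
    Measure.toSignedMeasure_apply_measurable hA, FiniteMeasure.toMeasure_smul,
    measureReal_nnreal_smul_apply, smul_eq_mul]
  ring

lemma diff_swap (μ ν : FiniteMeasure M) : diff ν μ = -diff μ ν := by
  simp [diff]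

variable [MetricSpace M]

/-- Finite first moment: `∫ d(x, x₀) dμ(x) < ∞` for all (equivalently, for some) `x₀`. -/
def HasFirstMoment (μ : FiniteMeasure M) : Prop :=
  ∀ x₀ : M, ∫⁻ x, edist x x₀ ∂(μ : Measure M) < ∞

lemma hasFirstMoment_of_exists {μ : FiniteMeasure M} {x₀ : M}
    (h : ∫⁻ x, edist x x₀ ∂(μ : Measure M) < ∞) : HasFirstMoment μ := by
  intro y
  calc ∫⁻ x, edist x y ∂(μ : Measure M)
      ≤ ∫⁻ x, (edist x x₀ + edist x₀ y) ∂(μ : Measure M) :=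
        lintegral_mono fun x => edist_triangle _ _ _
    _ = ∫⁻ x, edist x x₀ ∂(μ : Measure M) + edist x₀ y * (μ : Measure M) Set.univ := by
        rw [lintegral_add_right _ measurable_const, lintegral_const]
    _ < ∞ := ENNReal.add_lt_top.2
        ⟨h, ENNReal.mul_lt_top (edist_lt_top _ _) (measure_lt_top _ _)⟩

/-- The optimal transportation cost `T₁(μ, ν)`: the infimum of `∬ d(x, y) dπ(x, y)` over all
couplings `π` of `μ` and `ν`. -/
def optimalCost (μ ν : FiniteMeasure M) : ℝ≥0∞ :=
  ⨅ (π : Measure (M × M)) (_ : IsCoupling π μ ν), ∫⁻ z, edist z.1 z.2 ∂π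

/-- `(μ, ν)` is an admissible pair of measures: both have a finite first moment, and their total
masses agree. -/
structure Admissible (μ ν : FiniteMeasure M) : Prop where
  left : HasFirstMoment μ
  right : HasFirstMoment ν
  mass : μ.mass = ν.mass

lemma HasFirstMoment.add {μ ν : FiniteMeasure M} (h : HasFirstMoment μ) (h' : HasFirstMoment ν) :
    HasFirstMoment (μ + ν) := fun x₀ => by
  rw [FiniteMeasure.toMeasure_add, lintegral_add_measure]
  exact ENNReal.add_lt_top.2 ⟨h x₀, h' x₀⟩

lemma HasFirstMoment.smul {μ : FiniteMeasure M} (h : HasFirstMoment μ) (c : ℝ≥0) :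
    HasFirstMoment (c • μ) := fun x₀ => by
  rw [FiniteMeasure.toMeasure_smul, lintegral_smul_measure]
  exact ENNReal.mul_lt_top ENNReal.coe_lt_top (h x₀)

lemma Admissible.add {μ ν μ' ν' : FiniteMeasure M} (h : Admissible μ ν) (h' : Admissible μ' ν') :
    Admissible (μ + μ') (ν + ν') :=
  ⟨h.left.add h'.left, h.right.add h'.right, by
    have := h.mass; have := h'.mass
    simp_all [FiniteMeasure.mass]⟩

lemma Admissible.smul {μ ν : FiniteMeasure M} (h : Admissible μ ν) (c : ℝ≥0) :
    Admissible (c • μ) (c • ν) :=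
  ⟨h.left.smul c, h.right.smul c, by
    have := h.mass
    simp_all [FiniteMeasure.mass]⟩

lemma Admissible.swap {μ ν : FiniteMeasure M} (h : Admissible μ ν) : Admissible ν μ :=
  ⟨h.right, h.left, h.mass.symm⟩

lemma Admissible.zero : Admissible (0 : FiniteMeasure M) 0 :=
  ⟨fun _ => by simp, fun _ => by simp, rfl⟩

variable (M) in
/-- All differences `μ - ν` of finite Borel measures with finite first moment and equal total
mass, as a subspace of the signed measures on `M`. -/
def krSubmodule : Submodule ℝ (SignedMeasure M) where
  carrier := {s | ∃ μ ν : FiniteMeasure M, Admissible μ ν ∧ diff μ ν = s}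
  zero_mem' := ⟨0, 0, Admissible.zero, by simp [diff]⟩
  add_mem' := by
    rintro _ _ ⟨μ, ν, h, rfl⟩ ⟨μ', ν', h', rfl⟩
    exact ⟨μ + μ', ν + ν', h.add h', diff_add _ _ _ _⟩
  smul_mem' := by
    rintro c _ ⟨μ, ν, h, rfl⟩
    rcases le_total 0 c with hc | hc
    · exact ⟨c.toNNReal • μ, c.toNNReal • ν, h.smul _, by
        rw [diff_smul, Real.coe_toNNReal _ hc]⟩
    · exact ⟨(-c).toNNReal • ν, (-c).toNNReal • μ, h.swap.smul _, by
        rw [diff_smul, Real.coe_toNNReal _ (by linarith), diff_swap]; simp⟩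

/-- The infimum of `T₁(μ, ν)` over all representations `s = μ - ν` by an admissible pair. -/
def krENorm (s : SignedMeasure M) : ℝ≥0∞ :=
  ⨅ (μ : FiniteMeasure M) (ν : FiniteMeasure M) (_ : Admissible μ ν ∧ diff μ ν = s),
    optimalCost μ ν

lemma krENorm_le {μ ν : FiniteMeasure M} (h : Admissible μ ν) {π : Measure (M × M)}
    (hπ : IsCoupling π μ ν) : krENorm (diff μ ν) ≤ ∫⁻ z, edist z.1 z.2 ∂π :=
  (iInf₂_le_of_le μ ν (iInf_le _ ⟨h, rfl⟩)).trans (iInf₂_le π hπ)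

lemma le_krENorm {s : SignedMeasure M} {b : ℝ≥0∞}
    (H : ∀ μ ν : FiniteMeasure M, ∀ π : Measure (M × M), Admissible μ ν → diff μ ν = s →
      IsCoupling π μ ν → b ≤ ∫⁻ z, edist z.1 z.2 ∂π) : b ≤ krENorm s :=
  le_iInf fun μ => le_iInf fun ν => le_iInf fun h => le_iInf fun π => le_iInf fun hπ =>
    H μ ν π h.1 h.2 hπ

lemma krENorm_add_le (s t : SignedMeasure M) : krENorm (s + t) ≤ krENorm s + krENorm t := by
  rw [← tsub_le_iff_right]
  refine le_krENorm ?_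
  rintro μ ν π h rfl hπ
  rw [tsub_le_iff_right, ← tsub_le_iff_left]
  refine le_krENorm ?_
  rintro μ' ν' ρ h' rfl hρ
  rw [tsub_le_iff_left, ← diff_add, ← lintegral_add_measure]
  exact krENorm_le (h.add h') (hπ.add hρ)

lemma krENorm_smul_nnreal_le (c : ℝ≥0) (s : SignedMeasure M) :
    krENorm ((c : ℝ) • s) ≤ c * krENorm s := by
  rcases eq_or_ne c 0 with rfl | hc
  · have : IsCoupling (0 : Measure (M × M)) 0 0 := ⟨by simp, by simp⟩
    have := krENorm_le Admissible.zero this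
    simpa [diff] using this
  · have hc' : (c : ℝ≥0∞) ≠ 0 := by exact_mod_cast hc
    rw [mul_comm, ← ENNReal.div_le_iff hc' ENNReal.coe_ne_top]
    refine le_krENorm ?_
    rintro μ ν π h rfl hπ
    rw [ENNReal.div_le_iff hc' ENNReal.coe_ne_top, ← diff_smul]
    refine (krENorm_le (h.smul c) (hπ.smul c)).trans ?_
    rw [lintegral_smul_measure, mul_comm]
    rfl

lemma krENorm_neg_le (s : SignedMeasure M) : krENorm (-s) ≤ krENorm s := by
  refine le_krENorm ?_
  rintro μ ν π h rfl hπ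
  rw [← diff_swap]
  refine (krENorm_le h.swap hπ.swap).trans ?_
  refine (lintegral_map_le _ _).trans ?_
  simp [edist_comm]

lemma krENorm_smul_le (c : ℝ) (s : SignedMeasure M) :
    krENorm (c • s) ≤ ‖c‖₊ * krENorm s := by
  rcases le_total 0 c with hc | hc
  · have := krENorm_smul_nnreal_le ‖c‖₊ s
    rwa [coe_nnnorm, Real.norm_of_nonneg hc] at this
  · have := krENorm_smul_nnreal_le ‖c‖₊ s
    rw [coe_nnnorm, Real.norm_of_nonpos hc] at this
    refine le_trans ?_ this
    have h := krENorm_neg_le ((-c) • s)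
    have e : -((-c) • s) = c • s := by
      ext A _
      simp
    rwa [e] at h

variable [BorelSpace M]

lemma IsCoupling.cost_lt_top {π : Measure (M × M)} {μ ν : FiniteMeasure M} (h : Admissible μ ν)
    (hπ : IsCoupling π μ ν) : ∫⁻ z, edist z.1 z.2 ∂π < ∞ := by
  rcases isEmpty_or_nonempty M with hM | ⟨⟨o⟩⟩
  · simp [Measure.eq_zero_of_isEmpty π]
  · have hm : Measurable fun x : M => edist x o :=
      (continuous_id.edist continuous_const).measurable
    calc ∫⁻ z, edist z.1 z.2 ∂π ≤ ∫⁻ z, (edist z.1 o + edist z.2 o) ∂π :=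
          lintegral_mono fun z => edist_triangle_right _ _ _
      _ = ∫⁻ x, edist x o ∂(π.map Prod.fst) + ∫⁻ x, edist x o ∂(π.map Prod.snd) := by
          rw [lintegral_add_left (f := fun z : M × M => edist z.1 o) (hm.comp measurable_fst),
            lintegral_map hm measurable_fst, lintegral_map hm measurable_snd]
      _ < ∞ := by
          rw [hπ.map_fst, hπ.map_snd]
          exact ENNReal.add_lt_top.2 ⟨h.left o, h.right o⟩

lemma krENorm_lt_top {s : SignedMeasure M} (hs : s ∈ krSubmodule M) : krENorm s < ∞ := by
  obtain ⟨μ, ν, h, rfl⟩ := hs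
  obtain ⟨π, hπ⟩ := exists_isCoupling h.mass
  exact (krENorm_le h hπ).trans_lt (hπ.cost_lt_top h)

/-- The difference of the integrals of a bounded Lipschitz function is bounded by the norm. -/
lemma abs_integral_sub_le {l : M → ℝ} {K : ℝ≥0} (hK : K ≠ 0) (hl : LipschitzWith K l)
    (hb : ∀ x, |l x| ≤ 1) {μ ν : FiniteMeasure M} :
    ENNReal.ofReal |∫ x, l x ∂(μ : Measure M) - ∫ x, l x ∂(ν : Measure M)|
      ≤ K * krENorm (diff μ ν) := by
  have hi : ∀ ρ : FiniteMeasure M, Integrable l (ρ : Measure M) := fun ρ =>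
    Integrable.of_bound hl.continuous.measurable.aestronglyMeasurable 1
      (Filter.Eventually.of_forall hb)
  have main : ∀ μ' ν' : FiniteMeasure M, ∀ π : Measure (M × M), IsCoupling π μ' ν' →
      ENNReal.ofReal |∫ x, l x ∂(μ' : Measure M) - ∫ x, l x ∂(ν' : Measure M)|
        ≤ K * ∫⁻ z, edist z.1 z.2 ∂π := by
    intro μ' ν' π hπ
    have hm := hl.continuous.measurable
    have h1 : Integrable (fun z : M × M => l z.1) π := by
      have := hi μ'
      rw [← hπ.map_fst] at this
      exact this.comp_measurable measurable_fst
    have h2 : Integrable (fun z : M × M => l z.2) π := by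
      have := hi ν'
      rw [← hπ.map_snd] at this
      exact this.comp_measurable measurable_snd
    have e1 : ∫ x, l x ∂(μ' : Measure M) = ∫ z, l z.1 ∂π := by
      rw [← hπ.map_fst, integral_map measurable_fst.aemeasurable hm.aestronglyMeasurable]
    have e2 : ∫ x, l x ∂(ν' : Measure M) = ∫ z, l z.2 ∂π := by
      rw [← hπ.map_snd, integral_map measurable_snd.aemeasurable hm.aestronglyMeasurable]
    rw [e1, e2, ← integral_sub h1 h2, ← Real.norm_eq_abs, ofReal_norm]
    refine (enorm_integral_le_lintegral_enorm _).trans ?_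
    rw [← lintegral_const_mul' _ _ ENNReal.coe_ne_top]
    refine lintegral_mono fun z => ?_
    rw [← edist_eq_enorm_sub]
    exact hl z.1 z.2
  have hK' : (K : ℝ≥0∞) ≠ 0 := by exact_mod_cast hK
  rw [mul_comm, ← ENNReal.div_le_iff hK' ENNReal.coe_ne_top]
  refine le_krENorm ?_
  intro μ' ν' π _ hd hπ
  rw [ENNReal.div_le_iff hK' ENNReal.coe_ne_top, mul_comm]
  have hsum : (μ' : Measure M) + (ν : Measure M) = (μ : Measure M) + (ν' : Measure M) := by
    rw [← Measure.toSignedMeasure_eq_toSignedMeasure_iff, Measure.toSignedMeasure_add,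
      Measure.toSignedMeasure_add]
    simp only [diff] at hd
    exact sub_eq_sub_iff_add_eq_add.1 hd
  have hint : ∫ x, l x ∂(μ' : Measure M) + ∫ x, l x ∂(ν : Measure M) =
      ∫ x, l x ∂(μ : Measure M) + ∫ x, l x ∂(ν' : Measure M) := by
    rw [← integral_add_measure (hi μ') (hi ν), hsum, integral_add_measure (hi μ) (hi ν')]
  rw [show ∫ x, l x ∂(μ : Measure M) - ∫ x, l x ∂(ν : Measure M) =
    ∫ x, l x ∂(μ' : Measure M) - ∫ x, l x ∂(ν' : Measure M) by linarith]
  exact main μ' ν' π hπ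

lemma eq_zero_of_krENorm {s : SignedMeasure M} (hs : s ∈ krSubmodule M) (h : krENorm s = 0) :
    s = 0 := by
  obtain ⟨μ, ν, -, rfl⟩ := hs
  have hint : ∀ δ : ℝ, ∀ hδ : 0 < δ, ∀ E : Set M,
      ∫⁻ x, thickenedIndicator hδ E x ∂(μ : Measure M) =
        ∫⁻ x, thickenedIndicator hδ E x ∂(ν : Measure M) := by
    intro δ hδ E
    have hlip : LipschitzWith δ.toNNReal⁻¹ fun x => (thickenedIndicator hδ E x : ℝ) :=
      fun x y => lipschitzWith_thickenedIndicator hδ E x y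
    have hb : ∀ x, |(thickenedIndicator hδ E x : ℝ)| ≤ 1 := fun x => by
      rw [abs_of_nonneg (NNReal.coe_nonneg _)]
      exact_mod_cast thickenedIndicator_le_one hδ E x
    have := abs_integral_sub_le (μ := μ) (ν := ν)
      (inv_ne_zero (Real.toNNReal_pos.2 hδ).ne') hlip hb
    rw [h, mul_zero, nonpos_iff_eq_zero, ENNReal.ofReal_eq_zero] at this
    have h0 := sub_eq_zero.1 (abs_nonpos_iff.1 this)
    apply (ENNReal.toReal_eq_toReal_iff'
      (BoundedContinuousFunction.lintegral_lt_top_of_nnreal _ _).ne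
      (BoundedContinuousFunction.lintegral_lt_top_of_nnreal _ _).ne).1
    rw [BoundedContinuousFunction.toReal_lintegral_coe_eq_integral,
      BoundedContinuousFunction.toReal_lintegral_coe_eq_integral]
    exact h0
  have hclosed : ∀ F : Set M, IsClosed F → (μ : Measure M) F = (ν : Measure M) F := by
    intro F hF
    have hpos : ∀ n : ℕ, (0 : ℝ) < 1 / ((n : ℝ) + 1) := fun n => by positivity
    have h1 := tendsto_lintegral_thickenedIndicator_of_isClosed (μ : Measure M) hF hpos
      tendsto_one_div_add_atTop_nhds_zero_nat
    have h2 := tendsto_lintegral_thickenedIndicator_of_isClosed (ν : Measure M) hF hpos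
      tendsto_one_div_add_atTop_nhds_zero_nat
    simp only [hint] at h1
    exact tendsto_nhds_unique h1 h2
  have : (μ : Measure M) = (ν : Measure M) := by
    refine ext_of_generate_finite _ ?_ isPiSystem_isClosed (fun F hF => hclosed F hF)
      (hclosed _ isClosed_univ)
    rw [BorelSpace.measurable_eq (α := M), borel_eq_generateFrom_isClosed]
  have h' : μ = ν := Subtype.ext this
  simp [diff, h']

end kr

/-- The vector space `𝓜` of all differences `μ - ν` of finite Borel measures on `M` with finite
first moment and equal total mass. -/
def KR (M : Type*) [MeasurableSpace M] [MetricSpace M] : Type _ := ↥(krSubmodule M)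

section krNormed

variable {M : Type*} [MeasurableSpace M] [MetricSpace M]

instance : AddCommGroup (KR M) := inferInstanceAs (AddCommGroup ↥(krSubmodule M))

instance : Module ℝ (KR M) := inferInstanceAs (Module ℝ ↥(krSubmodule M))

/-- The element `μ - ν` of `𝓜` given by an admissible pair. -/
def KR.mk (μ ν : FiniteMeasure M) (h : Admissible μ ν) : KR M := ⟨diff μ ν, μ, ν, h, rfl⟩

instance : Norm (KR M) := ⟨fun s => (krENorm s.1).toReal⟩

variable [BorelSpace M]

lemma KR.norm_smul_le (c : ℝ) (s : KR M) : ‖c • s‖ ≤ ‖c‖ * ‖s‖ := by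
  have h := ENNReal.toReal_mono
    (ENNReal.mul_lt_top ENNReal.coe_lt_top (krENorm_lt_top s.2)).ne (krENorm_smul_le c s.1)
  rw [ENNReal.toReal_mul, ENNReal.coe_toReal, coe_nnnorm] at h
  exact h

lemma KR.core : NormedSpace.Core ℝ (KR M) where
  norm_nonneg s := ENNReal.toReal_nonneg
  norm_smul c s := by
    refine le_antisymm (KR.norm_smul_le c s) ?_
    rcases eq_or_ne c 0 with rfl | hc
    · rw [norm_zero, zero_mul]
      exact ENNReal.toReal_nonneg
    · have h := KR.norm_smul_le c⁻¹ (c • s)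
      rw [smul_smul, inv_mul_cancel₀ hc, one_smul, norm_inv] at h
      rwa [← le_inv_mul_iff₀ (norm_pos_iff.2 hc)]
  norm_triangle s t := by
    have hs := (krENorm_lt_top s.2).ne
    have ht := (krENorm_lt_top t.2).ne
    have h := ENNReal.toReal_mono (ENNReal.add_ne_top.2 ⟨hs, ht⟩) (krENorm_add_le s.1 t.1)
    rw [ENNReal.toReal_add hs ht] at h
    exact h
  norm_eq_zero_iff s := by
    refine ⟨fun h => Subtype.ext (eq_zero_of_krENorm s.2 ?_), ?_⟩
    · exact ((ENNReal.toReal_eq_zero_iff _).1 h).resolve_right (krENorm_lt_top s.2).ne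
    · rintro rfl
      have h := KR.norm_smul_le (M := M) 0 0
      rw [zero_smul, norm_zero, zero_mul] at h
      exact le_antisymm h ENNReal.toReal_nonneg

/-- `𝓜` with the Kantorovich–Rubinstein norm. The norm of `s` is the infimum of `T₁(μ, ν)` over
all representations `s = μ - ν`; that `T₁(μ, ν)` is in fact the same for all of them, so that
`‖μ - ν‖_KR = T₁(μ, ν)`, is part of the theorem. -/
instance : NormedAddCommGroup (KR M) := NormedAddCommGroup.ofCore KR.core

instance : NormedSpace ℝ (KR M) := NormedSpace.ofCore KR.core

end krNormed

/-! ### Transportation problems as differences of measures -/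

section embed

variable {M : Type*} [MeasurableSpace M]

/-- The signed measure `∑ f(x) δ_x` of a finitely supported function `f`. -/
def toAtomic (M : Type*) [MeasurableSpace M] : (M →₀ ℝ) →ₗ[ℝ] SignedMeasure M :=
  Finsupp.linearCombination ℝ fun x : M => (Measure.dirac x).toSignedMeasure

variable [MetricSpace M] [BorelSpace M]

lemma hasFirstMoment_dirac (x : M) :
    HasFirstMoment (⟨Measure.dirac x, inferInstance⟩ : FiniteMeasure M) := fun x₀ => by
  have hm : Measurable fun y : M => edist y x₀ :=
    (continuous_id.edist continuous_const).measurable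
  rw [FiniteMeasure.toMeasure_mk, lintegral_dirac' _ hm]
  exact edist_lt_top _ _

lemma toAtomic_mem {f : M →₀ ℝ} (hf : f ∈ tpSubmodule M) : toAtomic M f ∈ krSubmodule M := by
  have key : ∀ p : Plan M, toAtomic M p.problem ∈ krSubmodule M := by
    intro p
    induction p with
    | nil =>
      rw [Plan.problem_nil, map_zero]
      exact (krSubmodule M).zero_mem
    | cons t p ih =>
      rw [Plan.problem_cons, map_add, map_smul, map_sub]
      refine (krSubmodule M).add_mem ((krSubmodule M).smul_mem _ ?_) ih
      refine ⟨⟨Measure.dirac t.2.1, inferInstance⟩, ⟨Measure.dirac t.2.2, inferInstance⟩,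
        ⟨hasFirstMoment_dirac _, hasFirstMoment_dirac _, ?_⟩, ?_⟩
      · simp [FiniteMeasure.mass]
      · simp [diff, toAtomic]
  obtain ⟨p, rfl⟩ := exists_plan hf
  exact key p

/-- The canonical linear map of `TP(M)` into `𝓜`, `f ↦ ∑ f(x) δ_x`. -/
def TP.toKR : TP M →ₗ[ℝ] KR M :=
  ((toAtomic M).domRestrict (tpSubmodule M)).codRestrict (krSubmodule M)
    fun f => toAtomic_mem f.2

end embed

end TransportCost
end

/-!
The transportation cost `T₁` satisfies the triangle inequality, because couplings can be glued along
a common marginal (`exists_gluing`; completeness of `M` enters here, through the disintegration of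
measures). It is homogeneous, and adding the same measure to both sides does
not increase it.

The crucial fact is that adding a common measure `σ` does not decrease the cost either
(`optimalCost_le_add_right`). Carrying `n` copies of `μ` to `n` copies of `ν` one after another, each
time with the help of the same `σ`, gives `T₁(nμ + σ, nν + σ) ≤ n T₁(μ + σ, ν + σ)`. If
`c μ`, `c ν` and `σ` have the same mass, then replacing `σ` by `c μ` at the source and by `c ν` at the
target costs an amount `K` that does not depend on `n`, so that
`(n + c) T₁(μ, ν) ≤ K + n T₁(μ + σ, ν + σ)`; divide by `n` and let `n → ∞`. Since `μ - ν = μ' - ν'`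
means `μ + ν' = μ' + ν`, the cost `T₁(μ, ν)` depends on `μ - ν` only.

Hence the norm of a transportation problem `f` in `𝓜` is `T₁` of the measures with weights `f⁺`
and `f⁻`. A coupling of these lives on a finite set, and its atoms form a transportation plan for
`f` of the same cost (`ofReal_tcNorm_le`); conversely every plan bounds the norm in `𝓜`
(`Plan.krENorm_problem_le`). So the embedding of `TP(M)` is isometric. Its range is
dense since moving every point to the nearest of the first `N` points of a dense sequence costs
little for large `N` (`exists_finitely_supported_approx`). A dense isometric embedding induces an
isometry of the completions.
-/

noncomputable section

namespace TransportCost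

/-! ### Couplings and the optimal transportation cost -/

section Couplings

variable {M : Type*} [MeasurableSpace M]

lemma isCoupling_of_map {π : Measure (M × M)} {μ ν : FiniteMeasure M}
    (h₁ : π.map Prod.fst = (μ : Measure M)) (h₂ : π.map Prod.snd = (ν : Measure M)) :
    IsCoupling π μ ν := by
  refine ⟨fun A hA => ?_, fun A hA => ?_⟩
  · rw [← h₁, Measure.map_apply measurable_fst hA, ← Set.prod_univ]
  · rw [← h₂, Measure.map_apply measurable_snd hA, ← Set.univ_prod]

/-- The deterministic coupling of `μ` with its image under `φ`. -/
lemma isCoupling_map_graph (μ : FiniteMeasure M) {φ : M → M} (hφ : Measurable φ) :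
    IsCoupling ((μ : Measure M).map fun x => (x, φ x)) μ (μ.map φ) := by
  have hg : Measurable fun x => (x, φ x) := measurable_id.prodMk hφ
  refine isCoupling_of_map ?_ ?_
  · rw [Measure.map_map measurable_fst hg]
    exact Measure.map_id
  · rw [Measure.map_map measurable_snd hg]
    rfl

variable [MetricSpace M]

lemma optimalCost_le {π : Measure (M × M)} {μ ν : FiniteMeasure M} (h : IsCoupling π μ ν) :
    optimalCost μ ν ≤ ∫⁻ z, edist z.1 z.2 ∂π :=
  iInf₂_le π h

lemma le_optimalCost {μ ν : FiniteMeasure M} {b : ℝ≥0∞}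
    (H : ∀ π, IsCoupling π μ ν → b ≤ ∫⁻ z, edist z.1 z.2 ∂π) : b ≤ optimalCost μ ν :=
  le_iInf₂ H

lemma optimalCost_add_le (μ ν μ' ν' : FiniteMeasure M) :
    optimalCost (μ + μ') (ν + ν') ≤ optimalCost μ ν + optimalCost μ' ν' := by
  rw [← tsub_le_iff_right]
  refine le_optimalCost fun π hπ => ?_
  rw [tsub_le_iff_right, ← tsub_le_iff_left]
  refine le_optimalCost fun ρ hρ => ?_
  rw [tsub_le_iff_left, ← lintegral_add_measure]
  exact optimalCost_le (hπ.add hρ)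

lemma optimalCost_smul_le (c : ℝ≥0) (μ ν : FiniteMeasure M) (hc : c ≠ 0) :
    optimalCost (c • μ) (c • ν) ≤ c * optimalCost μ ν := by
  have hc' : (c : ℝ≥0∞) ≠ 0 := by exact_mod_cast hc
  rw [mul_comm, ← ENNReal.div_le_iff hc' ENNReal.coe_ne_top]
  refine le_optimalCost fun π hπ => ?_
  rw [ENNReal.div_le_iff hc' ENNReal.coe_ne_top]
  refine (optimalCost_le (hπ.smul c)).trans ?_
  rw [lintegral_smul_measure, mul_comm]
  rfl

lemma mul_optimalCost_le (c : ℝ≥0) (μ ν : FiniteMeasure M) (hc : c ≠ 0) :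
    c * optimalCost μ ν ≤ optimalCost (c • μ) (c • ν) := by
  have h := optimalCost_smul_le c⁻¹ (c • μ) (c • ν) (inv_ne_zero hc)
  rw [smul_smul, smul_smul, inv_mul_cancel₀ hc, one_smul, one_smul] at h
  calc (c : ℝ≥0∞) * optimalCost μ ν
      ≤ c * ((c⁻¹ : ℝ≥0) * optimalCost (c • μ) (c • ν)) := by gcongr
    _ = optimalCost (c • μ) (c • ν) := by
        rw [← mul_assoc, ← ENNReal.coe_mul, mul_inv_cancel₀ hc, ENNReal.coe_one, one_mul]

variable [BorelSpace M]

lemma optimalCost_lt_top {μ ν : FiniteMeasure M} (h : Admissible μ ν) : optimalCost μ ν < ∞ := by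
  obtain ⟨π, hπ⟩ := exists_isCoupling h.mass
  exact (optimalCost_le hπ).trans_lt (hπ.cost_lt_top h)

variable [SecondCountableTopology M]

lemma optimalCost_map_le (μ : FiniteMeasure M) {φ : M → M} (hφ : Measurable φ) :
    optimalCost μ (μ.map φ) ≤ ∫⁻ x, edist x (φ x) ∂(μ : Measure M) := by
  refine (optimalCost_le (isCoupling_map_graph μ hφ)).trans_eq ?_
  exact lintegral_map (measurable_fst.edist measurable_snd) (measurable_id.prodMk hφ)

lemma optimalCost_self (μ : FiniteMeasure M) : optimalCost μ μ = 0 := by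
  have h := optimalCost_map_le μ measurable_id
  have e : μ.map id = μ := Subtype.ext Measure.map_id
  simpa [e] using h

/-- Mass that stays in place costs nothing. -/
lemma optimalCost_add_left_le (σ μ ν : FiniteMeasure M) :
    optimalCost (σ + μ) (σ + ν) ≤ optimalCost μ ν := by
  simpa [optimalCost_self] using optimalCost_add_le σ σ μ ν

variable [CompleteSpace M]

/-- Couplings can be glued along a common marginal: `π ⊗ κ`, where `κ` is the conditional
distribution under `ρ` of the second coordinate given the first, is a measure on `(M × M) × M`
with the marginals `π` and `ρ`. -/
lemma exists_gluing {μ ν τ : FiniteMeasure M} {π ρ : Measure (M × M)} (hπ : IsCoupling π μ ν)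
    (hρ : IsCoupling ρ ν τ) :
    ∃ θ : Measure ((M × M) × M), θ.map Prod.fst = π ∧ θ.map (fun w => (w.1.2, w.2)) = ρ := by
  rcases isEmpty_or_nonempty M with hM | hM
  · exact ⟨0, by simp [Measure.eq_zero_of_isEmpty π], by simp [Measure.eq_zero_of_isEmpty ρ]⟩
  have := hπ.isFiniteMeasure
  have := hρ.isFiniteMeasure
  refine ⟨π.compProd (ρ.condKernel.comap Prod.snd measurable_snd),
    Measure.fst_compProd _ _, ?_⟩
  have hg : Measurable fun w : (M × M) × M => (w.1.2, w.2) := by fun_prop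
  have hm : π.map Prod.snd = ρ.fst := by rw [hπ.map_snd, Measure.fst, hρ.map_fst]
  ext A hA
  rw [Measure.map_apply hg hA, Measure.compProd_apply (hg hA)]
  conv_rhs => rw [← ρ.disintegrate ρ.condKernel, Measure.compProd_apply hA, ← hm,
    lintegral_map (ProbabilityTheory.Kernel.measurable_kernel_prodMk_left hA) measurable_snd]
  rfl

lemma optimalCost_triangle (μ ν τ : FiniteMeasure M) :
    optimalCost μ τ ≤ optimalCost μ ν + optimalCost ν τ := by
  rw [← tsub_le_iff_right]
  refine le_optimalCost fun π hπ => ?_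
  rw [tsub_le_iff_right, ← tsub_le_iff_left]
  refine le_optimalCost fun ρ hρ => ?_
  rw [tsub_le_iff_left]
  obtain ⟨θ, h₁, h₂⟩ := exists_gluing hπ hρ
  have hg : Measurable fun w : (M × M) × M => (w.1.2, w.2) := by fun_prop
  have hk : Measurable fun w : (M × M) × M => (w.1.1, w.2) := by fun_prop
  have he : Measurable fun z : M × M => edist z.1 z.2 := measurable_fst.edist measurable_snd
  have hθ : IsCoupling (θ.map fun w => (w.1.1, w.2)) μ τ := by
    refine isCoupling_of_map ?_ ?_
    · rw [Measure.map_map measurable_fst hk, ← hπ.map_fst, ← h₁,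
        Measure.map_map measurable_fst measurable_fst]
      rfl
    · rw [Measure.map_map measurable_snd hk, ← hρ.map_snd, ← h₂,
        Measure.map_map measurable_snd hg]
      rfl
  refine (optimalCost_le hθ).trans ?_
  rw [← h₁, ← h₂, lintegral_map he hk, lintegral_map he hg, lintegral_map he measurable_fst,
    ← lintegral_add_left (f := fun w : (M × M) × M => edist w.1.1 w.1.2) (he.comp measurable_fst)]
  exact lintegral_mono fun w => edist_triangle _ _ _

/-! ### Cancellation of common mass -/

/-- Transport `n` copies of `μ` one after another, each time with the help of the same `σ`. -/
lemma optimalCost_nsmul_add_le (μ ν σ : FiniteMeasure M) (n : ℕ) :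
    optimalCost (n • μ + σ) (n • ν + σ) ≤ n * optimalCost (μ + σ) (ν + σ) := by
  induction n with
  | zero => simp [optimalCost_self]
  | succ n ih =>
    calc optimalCost ((n + 1) • μ + σ) ((n + 1) • ν + σ)
        = optimalCost (μ + (n • μ + σ)) (n • ν + (ν + σ)) := by
          rw [succ_nsmul' μ, succ_nsmul ν, add_assoc, add_assoc]
      _ ≤ optimalCost (μ + (n • μ + σ)) (μ + (n • ν + σ)) +
          optimalCost (n • ν + (μ + σ)) (n • ν + (ν + σ)) := by
          rw [show n • ν + (μ + σ) = μ + (n • ν + σ) by abel]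
          exact optimalCost_triangle _ _ _
      _ ≤ n * optimalCost (μ + σ) (ν + σ) + optimalCost (μ + σ) (ν + σ) :=
          add_le_add ((optimalCost_add_left_le _ _ _).trans ih) (optimalCost_add_left_le _ _ _)
      _ = (n + 1 : ℕ) * optimalCost (μ + σ) (ν + σ) := by push_cast; ring

/-- Mass common to both measures does not make transportation cheaper. -/
lemma optimalCost_le_add_right {μ ν σ : FiniteMeasure M} (h : Admissible μ ν)
    (hσ : HasFirstMoment σ) : optimalCost μ ν ≤ optimalCost (μ + σ) (ν + σ) := by
  rcases eq_or_ne μ.mass 0 with h0 | h0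
  · have h1 : μ = 0 := (FiniteMeasure.mass_zero_iff μ).1 h0
    have h2 : ν = 0 := (FiniteMeasure.mass_zero_iff ν).1 (h.mass ▸ h0)
    rw [h1, h2, optimalCost_self]
    exact zero_le
  -- `c • μ` and `c • ν` have the same mass as `σ`, so `σ` may be replaced by `c • μ` at the source
  -- and by `c • ν` at the target, at a cost `K` independent of the number `n` of copies.
  set c : ℝ≥0 := σ.mass / μ.mass with hc
  have hm : ∀ τ : FiniteMeasure M, (c • τ).mass = c * τ.mass := fun τ => by
    simp [FiniteMeasure.mass]
  have a₁ : Admissible (c • μ) σ := ⟨h.left.smul c, hσ, by rw [hm, hc, div_mul_cancel₀ _ h0]⟩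
  have a₂ : Admissible σ (c • ν) :=
    ⟨hσ, h.right.smul c, by rw [hm, ← h.mass, hc, div_mul_cancel₀ _ h0]⟩
  have aσ : Admissible σ σ := ⟨hσ, hσ, rfl⟩
  set K : ℝ≥0∞ := optimalCost (c • μ) σ + optimalCost σ (c • ν) with hK
  have hKt : K ≠ ∞ := (ENNReal.add_lt_top.2 ⟨optimalCost_lt_top a₁, optimalCost_lt_top a₂⟩).ne
  set C := optimalCost (μ + σ) (ν + σ) with hC
  have hCt : C ≠ ∞ := (optimalCost_lt_top (h.add aσ)).ne
  have hT : optimalCost μ ν ≠ ∞ := (optimalCost_lt_top h).ne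
  have key : ∀ n : ℕ, n * optimalCost μ ν ≤ K + n * C := by
    intro n
    rcases eq_or_ne n 0 with rfl | hn
    · simp
    have e : ∀ τ : FiniteMeasure M, ((n : ℝ≥0) + c) • τ = n • τ + c • τ := fun τ => by
      rw [add_smul, Nat.cast_smul_eq_nsmul]
    calc (n : ℝ≥0∞) * optimalCost μ ν
        ≤ ((n + c : ℝ≥0) : ℝ≥0∞) * optimalCost μ ν := by
          gcongr
          push_cast
          exact le_self_add
      _ ≤ optimalCost (n • μ + c • μ) (n • ν + c • ν) := by
          rw [← e, ← e]
          exact mul_optimalCost_le _ _ _ (by positivity)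
      _ ≤ optimalCost (n • μ + c • μ) (n • μ + σ) + (optimalCost (n • μ + σ) (n • ν + σ) +
          optimalCost (n • ν + σ) (n • ν + c • ν)) :=
          (optimalCost_triangle _ _ _).trans (by gcongr; exact optimalCost_triangle _ _ _)
      _ ≤ optimalCost (c • μ) σ + (n * C + optimalCost σ (c • ν)) := by
          gcongr
          · exact optimalCost_add_left_le _ _ _
          · exact optimalCost_nsmul_add_le _ _ _ _
          · exact optimalCost_add_left_le _ _ _
      _ = K + n * C := by rw [hK]; ring
  have key' : ∀ n : ℕ, n * (optimalCost μ ν).toReal ≤ K.toReal + n * C.toReal := by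
    intro n
    have hn : (n : ℝ≥0∞) * C ≠ ∞ := ENNReal.mul_ne_top (ENNReal.natCast_ne_top n) hCt
    have := ENNReal.toReal_mono (ENNReal.add_ne_top.2 ⟨hKt, hn⟩) (key n)
    rwa [ENNReal.toReal_add hKt hn, ENNReal.toReal_mul, ENNReal.toReal_mul,
      ENNReal.toReal_natCast] at this
  rw [← ENNReal.toReal_le_toReal hT hCt]
  by_contra! hlt
  obtain ⟨n, hn⟩ := exists_nat_gt (K.toReal / ((optimalCost μ ν).toReal - C.toReal))
  rw [div_lt_iff₀ (sub_pos.2 hlt)] at hn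
  linarith [key' n]

lemma optimalCost_le_of_diff_eq {μ ν μ' ν' : FiniteMeasure M} (h : Admissible μ ν)
    (h' : Admissible μ' ν') (hd : diff μ' ν' = diff μ ν) :
    optimalCost μ ν ≤ optimalCost μ' ν' := by
  have hsum : ν' + μ = ν + μ' := by
    apply Subtype.ext
    change (ν' : Measure M) + (μ : Measure M) = (ν : Measure M) + (μ' : Measure M)
    rw [← Measure.toSignedMeasure_eq_toSignedMeasure_iff, Measure.toSignedMeasure_add,
      Measure.toSignedMeasure_add]
    simp only [diff] at hd
    rw [add_comm, ← sub_eq_sub_iff_add_eq_add.1 hd, add_comm]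
  calc optimalCost μ ν ≤ optimalCost (μ + ν') (ν + ν') := optimalCost_le_add_right h h'.right
    _ = optimalCost (ν + μ') (ν + ν') := by rw [add_comm μ, hsum]
    _ ≤ optimalCost μ' ν' := optimalCost_add_left_le _ _ _

lemma krENorm_diff {μ ν : FiniteMeasure M} (h : Admissible μ ν) :
    krENorm (diff μ ν) = optimalCost μ ν := by
  refine le_antisymm (le_optimalCost fun π hπ => krENorm_le h hπ) (le_krENorm ?_)
  intro μ' ν' π h' hd hπ
  exact (optimalCost_le_of_diff_eq h h' hd).trans (optimalCost_le hπ)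

lemma ofReal_norm_mk {μ ν : FiniteMeasure M} (h : Admissible μ ν) :
    ENNReal.ofReal ‖KR.mk μ ν h‖ = optimalCost μ ν := by
  change ENNReal.ofReal (krENorm (diff μ ν)).toReal = _
  rw [krENorm_diff h, ENNReal.ofReal_toReal (optimalCost_lt_top h).ne]

end Couplings

/-! ### Finitely supported measures -/

lemma measureReal_eq_sum_indicator {α : Type*} [MeasurableSpace α] [MeasurableSingletonClass α]
    (m : Measure α) [IsFiniteMeasure m] {F : Finset α} (hF : m (↑F)ᶜ = 0) (B : Set α) :
    m.real B = ∑ z ∈ F, m.real {z} * B.indicator 1 z := by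
  classical
  have h₁ : m.real B = m.real (↑(F.filter (· ∈ B)) : Set α) := by
    have hae : B =ᵐ[m] (↑(F.filter (· ∈ B)) : Set α) := by
      have : ∀ᵐ x ∂m, x ∈ (↑F : Set α) := hF
      filter_upwards [this] with x hx
      refine propext ⟨fun h => ?_, fun h => ?_⟩
      · exact Finset.mem_coe.2 (Finset.mem_filter.2 ⟨hx, h⟩)
      · exact (Finset.mem_filter.1 (Finset.mem_coe.1 h)).2
    exact measureReal_congr hae
  rw [h₁, ← sum_measureReal_singleton, Finset.sum_filter]
  refine Finset.sum_congr rfl fun z _ => ?_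
  by_cases hz : z ∈ B <;> simp [hz]

section Atomic

variable {M : Type*} [MeasurableSpace M]

lemma toAtomic_single (x : M) (a : ℝ) :
    toAtomic M (Finsupp.single x a) = a • (Measure.dirac x).toSignedMeasure := by
  simp [toAtomic]

lemma toAtomic_apply (f : M →₀ ℝ) {A : Set M} (hA : MeasurableSet A) :
    toAtomic M f A = f.sum fun x a => a * A.indicator 1 x := by
  induction f using Finsupp.induction_linear with
  | zero => simp
  | add f g hf hg =>
    rw [map_add, _root_.add_apply, hf, hg,
      Finsupp.sum_add_index' (by simp) (by intros; ring)]
  | single x a =>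
    rw [toAtomic_single, _root_.smul_apply, Measure.toSignedMeasure_apply_measurable hA,
      Finsupp.sum_single_index (by simp), measureReal_def, Measure.dirac_apply' _ hA, smul_eq_mul]
    by_cases hx : x ∈ A <;> simp [hx]

lemma toAtomic_injective [MeasurableSingletonClass M] : Function.Injective (toAtomic M) := by
  classical
  intro f g h
  ext v
  have key : ∀ f : M →₀ ℝ, toAtomic M f {v} = f v := by
    intro f
    rw [toAtomic_apply f (measurableSet_singleton v), Finsupp.sum, Finset.sum_eq_single v]
    · simp
    · intro x _ hx
      simp [hx]
    · intro hv
      simp [Finsupp.notMem_support_iff.1 hv]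
  rw [← key f, h, key g]

lemma mem_tpSubmodule_of_toAtomic_univ {f : M →₀ ℝ} (h : toAtomic M f Set.univ = 0) :
    f ∈ tpSubmodule M := by
  rw [toAtomic_apply f MeasurableSet.univ] at h
  change (f.sum fun _ a => a) = 0
  simpa using h

lemma exists_toAtomic_eq [MeasurableSingletonClass M] (m : Measure M) [IsFiniteMeasure m]
    {F : Finset M} (hF : m (↑F)ᶜ = 0) : ∃ f : M →₀ ℝ, toAtomic M f = m.toSignedMeasure := by
  refine ⟨∑ z ∈ F, Finsupp.single z (m.real {z}), ?_⟩
  ext A hA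
  rw [toAtomic_apply _ hA, Measure.toSignedMeasure_apply_measurable hA,
    measureReal_eq_sum_indicator m hF,
    ← Finsupp.sum_finsetSum_index (by simp) (by intros; ring)]
  exact Finset.sum_congr rfl fun z _ => Finsupp.sum_single_index (by simp)

variable [MetricSpace M] [BorelSpace M]

/-- Nonnegative weights on a finite set define a finite measure with finite first moment that is
concentrated on this set. -/
lemma exists_finiteMeasure_of_weights (c : M → ℝ≥0) (S : Finset M) :
    ∃ μ : FiniteMeasure M, HasFirstMoment μ ∧ (μ : Measure M) (↑S)ᶜ = 0 ∧
      (μ : Measure M).toSignedMeasure = toAtomic M (∑ x ∈ S, Finsupp.single x (c x : ℝ)) := by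
  classical
  induction S using Finset.induction_on with
  | empty => exact ⟨0, fun _ => by simp, by simp, by simp⟩
  | insert a S ha ih =>
    obtain ⟨μ, h₁, h₂, h₃⟩ := ih
    let δ : FiniteMeasure M := ⟨Measure.dirac a, inferInstance⟩
    have hδ : (δ : Measure M) = Measure.dirac a := rfl
    refine ⟨c a • δ + μ, ((hasFirstMoment_dirac a).smul (c a)).add h₁, ?_, ?_⟩
    · have hsub : (↑(insert a S) : Set M)ᶜ ⊆ (↑S)ᶜ :=
        Set.compl_subset_compl.2 (by exact_mod_cast Finset.subset_insert a S)
      rw [FiniteMeasure.toMeasure_add, Measure.add_apply, measure_mono_null hsub h₂,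
        FiniteMeasure.toMeasure_smul, Measure.smul_apply, hδ,
        Measure.dirac_apply' _ (Finset.measurableSet _).compl]
      simp
    · rw [Finset.sum_insert ha, map_add, ← h₃, toAtomic_single]
      ext A hA
      simp only [_root_.add_apply, _root_.smul_apply,
        Measure.toSignedMeasure_apply_measurable hA, FiniteMeasure.toMeasure_add]
      rw [measureReal_add_apply, FiniteMeasure.toMeasure_smul, measureReal_nnreal_smul_apply,
        hδ, smul_eq_mul]

/-- A transportation problem is the difference of two measures on its support: those with the
weights `f⁺` and `f⁻`. -/
lemma exists_admissible_diff_eq_toAtomic {f : M →₀ ℝ} (hf : f ∈ tpSubmodule M) :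
    ∃ μ ν : FiniteMeasure M, Admissible μ ν ∧ (μ : Measure M) (↑f.support)ᶜ = 0 ∧
      (ν : Measure M) (↑f.support)ᶜ = 0 ∧ diff μ ν = toAtomic M f := by
  obtain ⟨μ, hμ, hμ', eμ⟩ := exists_finiteMeasure_of_weights (fun x => (f x).toNNReal) f.support
  obtain ⟨ν, hν, hν', eν⟩ := exists_finiteMeasure_of_weights (fun x => (-f x).toNNReal) f.support
  have hd : diff μ ν = toAtomic M f := by
    rw [diff, eμ, eν, ← map_sub, ← Finset.sum_sub_distrib]
    congr 1
    conv_rhs => rw [← Finsupp.sum_single f, Finsupp.sum]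
    refine Finset.sum_congr rfl fun x _ => ?_
    rw [← Finsupp.single_sub, Real.coe_toNNReal', Real.coe_toNNReal', max_zero_sub_eq_self]
  refine ⟨μ, ν, ⟨hμ, hν, ?_⟩, hμ', hν', hd⟩
  have h0 : diff μ ν Set.univ = 0 := by
    rw [hd, toAtomic_apply f MeasurableSet.univ]
    have hf' : (f.sum fun _ a => a) = 0 := hf
    simpa using hf'
  rw [diff, _root_.sub_apply, Measure.toSignedMeasure_apply_measurable MeasurableSet.univ,
    Measure.toSignedMeasure_apply_measurable MeasurableSet.univ, sub_eq_zero] at h0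
  exact NNReal.coe_injective h0

/-! ### The embedding of `TP(M)` is isometric -/

lemma Plan.krENorm_problem_le (p : Plan M) :
    krENorm (toAtomic M p.problem) ≤ ENNReal.ofReal p.cost := by
  induction p with
  | nil =>
    rw [Plan.problem_nil, map_zero]
    have h := krENorm_smul_nnreal_le (M := M) 0 0
    rw [ENNReal.coe_zero, zero_mul, smul_zero] at h
    exact h.trans zero_le
  | cons t p ih =>
    obtain ⟨a, x, y⟩ := t
    have hδ : krENorm (toAtomic M (Finsupp.single x 1 - Finsupp.single y 1)) ≤ edist x y := by
      let δ : M → FiniteMeasure M := fun x => ⟨Measure.dirac x, inferInstance⟩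
      have hc : IsCoupling (Measure.dirac (x, y)) (δ x) (δ y) :=
        isCoupling_of_map (Measure.map_dirac' measurable_fst _)
          (Measure.map_dirac' measurable_snd _)
      have ha : Admissible (δ x) (δ y) :=
        ⟨hasFirstMoment_dirac x, hasFirstMoment_dirac y, by simp [δ, FiniteMeasure.mass]⟩
      have e : toAtomic M (Finsupp.single x 1 - Finsupp.single y 1) = diff (δ x) (δ y) := by
        simp [toAtomic_single, diff, δ]
      rw [e]
      refine (krENorm_le ha hc).trans_eq ?_
      rw [lintegral_dirac]
    rw [Plan.problem_cons, Plan.cost_cons, map_add, map_smul]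
    dsimp only
    rw [ENNReal.ofReal_add (mul_nonneg a.coe_nonneg dist_nonneg) (Plan.cost_nonneg p), ENNReal.ofReal_mul a.coe_nonneg, ← edist_dist,
      ENNReal.ofReal_coe_nnreal]
    refine (krENorm_add_le _ _).trans (add_le_add ?_ ih)
    exact (krENorm_smul_nnreal_le _ _).trans (by gcongr)

/-- A coupling of two measures on a finite set `S` is a transportation plan: its atoms are the
amounts to be delivered. -/
lemma ofReal_tcNorm_le {f : M →₀ ℝ} {μ ν : FiniteMeasure M} {S : Finset M}
    (hμ : (μ : Measure M) (↑S)ᶜ = 0) (hν : (ν : Measure M) (↑S)ᶜ = 0)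
    (hd : diff μ ν = toAtomic M f) {π : Measure (M × M)} (hπ : IsCoupling π μ ν) :
    ENNReal.ofReal (tcNorm f) ≤ ∫⁻ z, edist z.1 z.2 ∂π := by
  classical
  have := hπ.isFiniteMeasure
  have hF : π (↑(S ×ˢ S))ᶜ = 0 := by
    have hS : MeasurableSet (↑S : Set M)ᶜ := S.measurableSet.compl
    have h₁ : π ((↑S)ᶜ ×ˢ Set.univ) = 0 := by rw [hπ.1 _ hS, hμ]
    have h₂ : π (Set.univ ×ˢ (↑S)ᶜ) = 0 := by rw [hπ.2 _ hS, hν]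
    rw [Finset.coe_product, Set.compl_prod_eq_union]
    exact measure_union_null h₁ h₂
  let p : Plan M := (S ×ˢ S).toList.map fun z => ((π {z}).toNNReal, z.1, z.2)
  have hp : p.problem = ∑ z ∈ S ×ˢ S, π.real {z} •
      (Finsupp.single z.1 (1 : ℝ) - Finsupp.single z.2 (1 : ℝ)) := by
    simp only [p, Plan.problem, List.map_map]
    exact Finset.sum_map_toList _ _
  have hc : p.cost = ∑ z ∈ S ×ˢ S, π.real {z} * dist z.1 z.2 := by
    simp only [p, Plan.cost, List.map_map]
    exact Finset.sum_map_toList _ _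
  have hpf : p.problem = f := by
    apply toAtomic_injective
    rw [← hd]
    ext A hA
    have e₁ : (μ : Measure M).real A = π.real (A ×ˢ Set.univ) := by
      rw [measureReal_def, measureReal_def, hπ.1 A hA]
    have e₂ : (ν : Measure M).real A = π.real (Set.univ ×ˢ A) := by
      rw [measureReal_def, measureReal_def, hπ.2 A hA]
    rw [diff, _root_.sub_apply, Measure.toSignedMeasure_apply_measurable hA,
      Measure.toSignedMeasure_apply_measurable hA, e₁, e₂, measureReal_eq_sum_indicator π hF,
      measureReal_eq_sum_indicator π hF, ← Finset.sum_sub_distrib, toAtomic_apply _ hA, hp,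
      ← Finsupp.sum_finsetSum_index (by simp) (by intros; ring)]
    refine Finset.sum_congr rfl fun z _ => ?_
    rw [← toAtomic_apply _ hA, map_smul, map_sub, _root_.smul_apply, _root_.sub_apply,
      toAtomic_apply _ hA, toAtomic_apply _ hA, Finsupp.sum_single_index (by simp),
      Finsupp.sum_single_index (by simp), smul_eq_mul]
    by_cases h₁ : z.1 ∈ A <;> by_cases h₂ : z.2 ∈ A <;> simp [h₁, h₂, Set.indicator]
  have hcost : ENNReal.ofReal p.cost = ∫⁻ z, edist z.1 z.2 ∂π := by
    have hres : π.restrict (↑(S ×ˢ S)) = π := Measure.restrict_eq_self_of_ae_mem hF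
    rw [hc, ← hres, lintegral_finset, hres, ENNReal.ofReal_sum_of_nonneg fun _ _ => by positivity]
    refine Finset.sum_congr rfl fun z _ => ?_
    rw [ENNReal.ofReal_mul measureReal_nonneg, ← edist_dist, ofReal_measureReal, mul_comm]
  rw [← hcost]
  exact ENNReal.ofReal_le_ofReal (tcNorm_le p hpf)

variable [CompleteSpace M] [SecondCountableTopology M]

lemma norm_toKR (f : TP M) : ‖TP.toKR f‖ = ‖f‖ := by
  change (krENorm (toAtomic M f.1)).toReal = tcNorm f.1
  refine le_antisymm (le_tcNorm f.2 fun p hp => ?_) ?_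
  · rw [← hp]
    exact ENNReal.toReal_le_of_le_ofReal p.cost_nonneg p.krENorm_problem_le
  · obtain ⟨μ, ν, h, hμ, hν, hd⟩ := exists_admissible_diff_eq_toAtomic f.2
    rw [← ENNReal.ofReal_le_iff_le_toReal (krENorm_lt_top (toAtomic_mem f.2)).ne, ← hd,
      krENorm_diff h]
    exact le_optimalCost fun π hπ => ofReal_tcNorm_le hμ hν hd hπ

/-! ### Density of `TP(M)` -/

/-- Moving all mass to the nearest of the first `N` points of a dense sequence is cheap for large
`N`: the distance moved decreases to `0`, and is dominated by the distance to the first point. -/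
lemma exists_finitely_supported_approx {μ : FiniteMeasure M} (hμ : HasFirstMoment μ) {ε : ℝ≥0∞}
    (hε : 0 < ε) : ∃ μ' : FiniteMeasure M, Admissible μ μ' ∧ optimalCost μ μ' < ε ∧
      ∃ f : M →₀ ℝ, toAtomic M f = (μ' : Measure M).toSignedMeasure := by
  rcases isEmpty_or_nonempty M with hM | hM
  · refine ⟨μ, ⟨hμ, hμ, rfl⟩, by rwa [optimalCost_self], ?_⟩
    exact exists_toAtomic_eq (F := ∅) _ (by simp [Set.eq_empty_of_isEmpty])
  let e := TopologicalSpace.denseSeq M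
  let φ : ℕ → SimpleFunc M M := SimpleFunc.nearestPt e
  have hbound : ∀ N x, edist x (φ N x) ≤ edist x (e 0) := fun N x => by
    rw [edist_comm x, edist_comm x]
    exact SimpleFunc.edist_nearestPt_le e x N.zero_le
  have hlim : Filter.Tendsto (fun N => ∫⁻ x, edist x (φ N x) ∂(μ : Measure M)) Filter.atTop
      (𝓝 0) := by
    rw [show (0 : ℝ≥0∞) = ∫⁻ _, 0 ∂(μ : Measure M) by simp]
    refine tendsto_lintegral_of_dominated_convergence (fun x => edist x (e 0))
      (fun N => measurable_id.edist (φ N).measurable)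
      (fun N => Filter.Eventually.of_forall (hbound N)) (hμ (e 0)).ne
      (Filter.Eventually.of_forall fun x => ?_)
    have h := SimpleFunc.tendsto_nearestPt (e := e) (x := x)
      (TopologicalSpace.denseRange_denseSeq M x)
    simpa using (tendsto_const_nhds (x := x)).edist h
  obtain ⟨N, hN⟩ := (hlim.eventually_lt_const hε).exists
  have hφ := (φ N).measurable
  refine ⟨μ.map (φ N), ⟨hμ, ?_, ?_⟩, (optimalCost_map_le μ hφ).trans_lt hN, ?_⟩
  · refine hasFirstMoment_of_exists (x₀ := e 0) ?_
    have hm : Measurable fun y : M => edist y (e 0) :=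
      (continuous_id.edist continuous_const).measurable
    rw [FiniteMeasure.toMeasure_map, lintegral_map hm hφ]
    calc ∫⁻ x, edist (φ N x) (e 0) ∂(μ : Measure M)
        ≤ ∫⁻ x, (edist x (e 0) + edist x (e 0)) ∂(μ : Measure M) :=
          lintegral_mono fun x => (edist_triangle_left _ _ x).trans (by gcongr; exact hbound N x)
      _ = ∫⁻ x, edist x (e 0) ∂(μ : Measure M) + ∫⁻ x, edist x (e 0) ∂(μ : Measure M) :=
          lintegral_add_left hm _
      _ < ∞ := ENNReal.add_lt_top.2 ⟨hμ _, hμ _⟩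
  · exact (by
      rw [FiniteMeasure.mass, FiniteMeasure.mass, FiniteMeasure.map_apply _ hφ MeasurableSet.univ,
        Set.preimage_univ])
  · refine exists_toAtomic_eq (F := (φ N).range) _ ?_
    rw [FiniteMeasure.toMeasure_map, Measure.map_apply hφ (Finset.measurableSet _).compl]
    convert measure_empty (μ := (μ : Measure M))
    ext x
    simp

lemma denseRange_toKR : DenseRange (TP.toKR : TP M → KR M) := by
  intro s
  rw [Metric.mem_closure_range_iff]
  intro ε hε
  obtain ⟨_, μ, ν, h, rfl⟩ := s
  have hε' : 0 < ENNReal.ofReal (ε / 2) := ENNReal.ofReal_pos.2 (by positivity)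
  obtain ⟨μ', hμ, cμ, f, hf⟩ := exists_finitely_supported_approx h.left hε'
  obtain ⟨ν', hν, cν, g, hg⟩ := exists_finitely_supported_approx h.right hε'
  have h' : Admissible μ' ν' := ⟨hμ.right, hν.right, by rw [← hμ.mass, h.mass, hν.mass]⟩
  have hfg : toAtomic M (f - g) = diff μ' ν' := by rw [map_sub, hf, hg, diff]
  have h0 : toAtomic M (f - g) Set.univ = 0 := by
    rw [hfg, diff, _root_.sub_apply, Measure.toSignedMeasure_apply_measurable MeasurableSet.univ,
      Measure.toSignedMeasure_apply_measurable MeasurableSet.univ, sub_eq_zero]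
    exact congrArg NNReal.toReal h'.mass
  refine ⟨⟨f - g, mem_tpSubmodule_of_toAtomic_univ h0⟩, ?_⟩
  have e : KR.mk μ ν h - TP.toKR ⟨f - g, mem_tpSubmodule_of_toAtomic_univ h0⟩ =
      KR.mk μ μ' hμ - KR.mk ν ν' hν := by
    apply Subtype.ext
    change diff μ ν - toAtomic M (f - g) = diff μ μ' - diff ν ν'
    rw [hfg]
    simp only [diff]
    abel
  have n₁ : ‖KR.mk μ μ' hμ‖ < ε / 2 := by
    rwa [← ofReal_norm_mk hμ, ENNReal.ofReal_lt_ofReal_iff (by positivity)] at cμ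
  have n₂ : ‖KR.mk ν ν' hν‖ < ε / 2 := by
    rwa [← ofReal_norm_mk hν, ENNReal.ofReal_lt_ofReal_iff (by positivity)] at cν
  calc dist (KR.mk μ ν h) (TP.toKR ⟨f - g, mem_tpSubmodule_of_toAtomic_univ h0⟩)
      = ‖KR.mk μ μ' hμ - KR.mk ν ν' hν‖ := by rw [dist_eq_norm, e]
    _ ≤ ‖KR.mk μ μ' hμ‖ + ‖KR.mk ν ν' hν‖ := norm_sub_le _ _
    _ < ε := by linarith

end Atomic

end TransportCost
end

theorem mainTheorem9 (M : Type*) [MetricSpace M] [CompleteSpace M]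
    [TopologicalSpace.SeparableSpace M] [MeasurableSpace M] [BorelSpace M] :
    -- the norm of `𝓜` is given by optimal transportation cost, whatever the representation
    (∀ (μ ν : MeasureTheory.FiniteMeasure M) (h : TransportCost.Admissible μ ν),
      ENNReal.ofReal ‖TransportCost.KR.mk μ ν h‖ = TransportCost.optimalCost μ ν) ∧
    -- `TP(M)` is, isometrically, a subspace of `𝓜`, and it is dense there
    (∀ f : TransportCost.TP M, ‖TransportCost.TP.toKR f‖ = ‖f‖) ∧
    DenseRange (TransportCost.TP.toKR : TransportCost.TP M → TransportCost.KR M) ∧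
    -- `TC(M)` is the completion of `𝓜`, by an isometry that is the identity on `TP(M)`
    ∃ Φ : UniformSpace.Completion (TransportCost.KR M) ≃ₗᵢ[ℝ] TransportCost.TC M,
      ∀ f : TransportCost.TP M,
        Φ ((TransportCost.TP.toKR f : TransportCost.KR M) :
          UniformSpace.Completion (TransportCost.KR M)) = (f : TransportCost.TC M) := by
  have := UniformSpace.secondCountable_of_separable M
  refine ⟨fun μ ν h => TransportCost.ofReal_norm_mk h, TransportCost.norm_toKR,
    TransportCost.denseRange_toKR, ?_⟩
  let e₁ : TransportCost.TP M →ₗ[ℝ] UniformSpace.Completion (TransportCost.KR M) :=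
    (UniformSpace.Completion.toComplₗᵢ (𝕜 := ℝ) (E := TransportCost.KR M)).toLinearMap ∘ₗ
      TransportCost.TP.toKR
  let e₂ : TransportCost.TP M →ₗ[ℝ] TransportCost.TC M :=
    (UniformSpace.Completion.toComplₗᵢ (𝕜 := ℝ) (E := TransportCost.TP M)).toLinearMap
  have h₁ : DenseRange e₁ :=
    UniformSpace.Completion.denseRange_coe.comp TransportCost.denseRange_toKR
      (UniformSpace.Completion.continuous_coe _)
  have h₂ : DenseRange e₂ := UniformSpace.Completion.denseRange_coe
  have hn : ∀ f, ‖e₂ (LinearEquiv.refl ℝ (TransportCost.TP M) f)‖ = ‖e₁ f‖ := fun f => by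
    change ‖(f : TransportCost.TC M)‖ = ‖((TransportCost.TP.toKR f : TransportCost.KR M) :
      UniformSpace.Completion (TransportCost.KR M))‖
    rw [UniformSpace.Completion.norm_coe, UniformSpace.Completion.norm_coe,
      TransportCost.norm_toKR]
  exact ⟨(LinearEquiv.refl ℝ (TransportCost.TP M)).extendOfIsometry e₁ e₂ h₁ h₂ hn,
    fun f => LinearEquiv.extendOfIsometry_eq _ _ _ h₁ h₂ hn f⟩
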